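/- Let $p:\mathbb R^d\to(0,\infty)$ be differentiable (a positive, possibly unnormalized, density) and let $k:\mathbb R^d\times\mathbb R^d\to\mathbb R$ be measurable and differentiable in its first argument. For a probability density $q$ on $\mathbb R^d$ put $$A_q(y)=\mathbb E_{x\sim q}\big[\nabla\log p(x)\,k(x,y)+\nabla_x k(x,y)\big].$$ Let $(x^t)_{t\in[0,T]}$ be random vectors in $\mathbb R^d$ on a common probability space such that $x^t$ has a density $q_t$ for every $t\in[0,T]$, the expectation $A_{q_t}(y)$ is finite (that is, its integrand is $q_t$-integrable) for all $t\in[0,T]$ and $y\in\mathbb R^d$, and almost surely $$\frac{dx^t}{dt}=A_{q_t}(x^t)=\mathbb E_{x\sim q_t}\big[\nabla\log p(x)\,k(x,x^t)+\nabla_x k(x,x^t)\big]\qquad\text{for all }t\in[0,T]$$ (with one-sided derivatives at $t=0$ and $t=T$). Assume that $\int_0^T\!\int_K q_t(x)\,|A_{q_t}(x)|\,dx\,dt<\infty$ for every compact $K\subset\mathbb R^d$. Then $q_t$ satisfies $$\frac{\partial q_t}{\partial t}=-\operatorname{div}\big(q_t\,A_{q_t}\big),\qquad \operatorname{div} f=\sum_{i=1}^d\frac{\partial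 f_i}{\partial x_i},$$ in the following two senses. (1) (Weak sense.) For every compactly supported $C^1$ function $\psi(t,x)$ on $\mathbb R\times\mathbb R^d$ and every $t\in[0,T]$, $$\int q_t(x)\psi(t,x)\,dx=\int q_0(x)\psi(0,x)\,dx+\int_0^t\!\int q_s(x)\Big(\frac{\partial\psi}{\partial s}(s,x)+A_{q_s}(x)\cdot\nabla_x\psi(s,x)\Big)dx\,ds .$$ (2) (Classical sense.) The equation holds at every point of every open set $U\subset(0,T)\times\mathbb R^d$ on which the derivatives $\partial q_t/\partial t$ and $\nabla_x(q_tA_{q_t})$ exist and are continuous in $(t,x)$; in particular on all of $(0,T)\times\mathbb R^d$ if these derivatives exist and are continuous there. -/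

import Mathlib

open MeasureTheory Set

namespace SteinFlow

/-- The score `s_p = ∇ log p`. -/
noncomputable def score {d : ℕ} (p : EuclideanSpace ℝ (Fin d) → ℝ)
    (x : EuclideanSpace ℝ (Fin d)) : EuclideanSpace ℝ (Fin d) :=
  gradient (fun z => Real.log (p z)) x

/-- The Stein operator of `p` applied to `k(·, y)`, at `x`: `s_p(x) k(x, y) + ∇ₓ k(x, y)`. -/
noncomputable def steinKernel {d : ℕ} (p : EuclideanSpace ℝ (Fin d) → ℝ)
    (k : EuclideanSpace ℝ (Fin d) → EuclideanSpace ℝ (Fin d) → ℝ)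
    (x y : EuclideanSpace ℝ (Fin d)) : EuclideanSpace ℝ (Fin d) :=
  k x y • score p x + gradient (fun z => k z y) x

/-- The velocity field `y ↦ 𝔼_{x ∼ ρ}[s_p(x) k(x, y) + ∇ₓ k(x, y)]`, where `ρ` is a density. -/
noncomputable def velocity {d : ℕ} (p : EuclideanSpace ℝ (Fin d) → ℝ)
    (k : EuclideanSpace ℝ (Fin d) → EuclideanSpace ℝ (Fin d) → ℝ)
    (ρ : EuclideanSpace ℝ (Fin d) → ℝ) (y : EuclideanSpace ℝ (Fin d)) :
    EuclideanSpace ℝ (Fin d) :=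
  ∫ x, ρ x • steinKernel p k x y

/-- The flux `ρ(y) 𝔼_{x ∼ ρ}[s_p(x) k(x, y) + ∇ₓ k(x, y)]`. -/
noncomputable def flux {d : ℕ} (p : EuclideanSpace ℝ (Fin d) → ℝ)
    (k : EuclideanSpace ℝ (Fin d) → EuclideanSpace ℝ (Fin d) → ℝ)
    (ρ : EuclideanSpace ℝ (Fin d) → ℝ) (y : EuclideanSpace ℝ (Fin d)) :
    EuclideanSpace ℝ (Fin d) :=
  ρ y • velocity p k ρ y

/-- The divergence `∑ i, ∂fᵢ/∂xᵢ` of a vector field. -/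
noncomputable def divergence {d : ℕ}
    (f : EuclideanSpace ℝ (Fin d) → EuclideanSpace ℝ (Fin d))
    (x : EuclideanSpace ℝ (Fin d)) : ℝ :=
  ∑ i, (fderiv ℝ f x (EuclideanSpace.single i 1)) i

/-- `ρ` is a probability density function of the random vector `Y`. -/
structure IsDensityOf {d : ℕ} {Ω : Type*} [MeasurableSpace Ω] (P : Measure Ω)
    (Y : Ω → EuclideanSpace ℝ (Fin d)) (ρ : EuclideanSpace ℝ (Fin d) → ℝ) : Prop where
  measurable : Measurable ρ
  nonneg : ∀ x, 0 ≤ ρ x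
  map_eq : P.map Y = volume.withDensity (fun x => ENNReal.ofReal (ρ x))

/-- On the time interval `[0, T]` the random vectors `X t` have densities `q t`, and the paths of
`X` solve `d X_t / dt = 𝔼_{x ∼ q_t}[s_p(x) k(x, X_t) + ∇ₓ k(x, X_t)]`, all the
expectations being finite. -/
structure IsSteinProcess {d : ℕ} {Ω : Type*} [MeasurableSpace Ω] (P : Measure Ω)
    (p : EuclideanSpace ℝ (Fin d) → ℝ)
    (k : EuclideanSpace ℝ (Fin d) → EuclideanSpace ℝ (Fin d) → ℝ) (T : ℝ)
    (X : ℝ → Ω → EuclideanSpace ℝ (Fin d)) (q : ℝ → EuclideanSpace ℝ (Fin d) → ℝ) : Prop where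
  measurable : ∀ t ∈ Icc 0 T, Measurable (X t)
  density : ∀ t ∈ Icc 0 T, IsDensityOf P (X t) (q t)
  integrable : ∀ t ∈ Icc 0 T, ∀ y, Integrable (fun x => q t x • steinKernel p k x y)
  ode : ∀ᵐ ω ∂P, ∀ t ∈ Icc 0 T,
    HasDerivWithinAt (fun s => X s ω) (velocity p k (q t) (X t ω)) (Icc 0 T) t

/-- `q` solves `∂q/∂t = -div(q A)` on `[0, T] × ℝᵈ` in the weak sense, with initial value `q 0`:
the equation is tested against compactly supported `C¹` functions of time and space. -/
def IsWeakSolution {d : ℕ} (T : ℝ) (q : ℝ → EuclideanSpace ℝ (Fin d) → ℝ)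
    (A : ℝ → EuclideanSpace ℝ (Fin d) → EuclideanSpace ℝ (Fin d)) : Prop :=
  ∀ ψ : ℝ → EuclideanSpace ℝ (Fin d) → ℝ,
    ContDiff ℝ 1 (fun z : ℝ × EuclideanSpace ℝ (Fin d) => ψ z.1 z.2) →
    HasCompactSupport (fun z : ℝ × EuclideanSpace ℝ (Fin d) => ψ z.1 z.2) →
    ∀ t ∈ Icc 0 T,
      ∫ x, q t x * ψ t x = (∫ x, q 0 x * ψ 0 x) +
        ∫ s in (0 : ℝ)..t, ∫ x,
          q s x * (deriv (fun r => ψ r x) s + inner ℝ (A s x) (gradient (ψ s) x))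

end SteinFlow

/-! For a test function `ψ`, the chain rule along almost every path gives the derivative of `ψ s (X
s ω)` as the space-time differential of `ψ` applied to `(1, velocity)`. Integrating in time, taking
expectations, exchanging the two by Fubini and turning expectations at fixed time into integrals
against `q s` yields the weak equation (`IsSteinProcess.isWeakSolution`).

The delicate point is Fubini: `q` is measurable in space for each time only, so joint measurability
of the velocity is not given. It is recovered by replacing `X` with a jointly measurable version `Y`
and writing the velocity as the expectation of the Stein kernel at `Y s`. Integrability comes from
the local bound on the flux, because `ψ` has compact support.

For the classical equation (`IsWeakSolution.deriv_eq`), test with a bump supported in `U` and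
integrate by parts in time and in space. The integral of `∂q/∂t + div(q A)` against the bump
vanishes. If this continuous function were nonzero at a point, a bump supported where it keeps its
sign would contradict that. -/

namespace SteinFlow

/-! ### Densities -/

section Density

variable {d : ℕ} {Ω : Type*} [MeasurableSpace Ω] {P : Measure Ω}
  {Z : Ω → EuclideanSpace ℝ (Fin d)} {ρ : EuclideanSpace ℝ (Fin d) → ℝ}

theorem IsDensityOf.integral_smul (h : IsDensityOf P Z ρ) (hZ : Measurable Z)
    {F : Type*} [NormedAddCommGroup F] [NormedSpace ℝ F]
    {g : EuclideanSpace ℝ (Fin d) → F} (hg : StronglyMeasurable g) :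
    ∫ x, ρ x • g x = ∫ ω, g (Z ω) ∂P := by
  rw [← integral_map hZ.aemeasurable hg.aestronglyMeasurable, h.map_eq,
    integral_withDensity_eq_integral_toReal_smul h.measurable.ennreal_ofReal
      (Filter.Eventually.of_forall fun _ => ENNReal.ofReal_lt_top)]
  simp only [ENNReal.toReal_ofReal (h.nonneg _)]

theorem IsDensityOf.lintegral_mul (h : IsDensityOf P Z ρ) (hZ : Measurable Z)
    {g : EuclideanSpace ℝ (Fin d) → ENNReal} (hg : Measurable g) :
    ∫⁻ x, ENNReal.ofReal (ρ x) * g x = ∫⁻ ω, g (Z ω) ∂P := by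
  rw [← lintegral_map hg hZ, h.map_eq,
    lintegral_withDensity_eq_lintegral_mul _ h.measurable.ennreal_ofReal hg]
  rfl

theorem IsDensityOf.lintegral_eq_one [IsProbabilityMeasure P] (h : IsDensityOf P Z ρ)
    (hZ : Measurable Z) : ∫⁻ x, ENNReal.ofReal (ρ x) = 1 := by
  simpa using h.lintegral_mul hZ (g := fun _ => 1) measurable_const

end Density

/-! ### Measurability -/

section Measurability

variable {d : ℕ}

theorem measurable_euclidean {α : Type*} [MeasurableSpace α] {f : α → EuclideanSpace ℝ (Fin d)}
    (hf : ∀ i, Measurable fun a => f a i) : Measurable f :=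
  (WithLp.measurable_toLp 2 (Fin d → ℝ)).comp (measurable_pi_lambda _ hf)

theorem gradient_apply (f : EuclideanSpace ℝ (Fin d) → ℝ) (x : EuclideanSpace ℝ (Fin d))
    (i : Fin d) : gradient f x i = fderiv ℝ f x (EuclideanSpace.single i 1) := by
  have h : inner ℝ (gradient f x) (EuclideanSpace.single i (1 : ℝ)) =
      fderiv ℝ f x (EuclideanSpace.single i 1) := by
    rw [gradient, InnerProductSpace.toDual_symm_apply]
  rw [← h, EuclideanSpace.inner_single_right]
  simp

theorem inner_gradient (f : EuclideanSpace ℝ (Fin d) → ℝ) (x v : EuclideanSpace ℝ (Fin d)) :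
    inner ℝ v (gradient f x) = fderiv ℝ f x v := by
  rw [real_inner_comm, gradient, InnerProductSpace.toDual_symm_apply]

/-- The directional derivative is a pointwise limit of difference quotients with step `1/n`, each
jointly measurable. No continuity in the parameter is needed, so the lemma applies to a kernel that
is merely measurable in its second argument. -/
theorem measurable_fderiv_apply_of_differentiable {E α : Type*} [NormedAddCommGroup E]
    [NormedSpace ℝ E] [MeasurableSpace E] [BorelSpace E] [SecondCountableTopology E]
    [MeasurableSpace α] {f : E → α → ℝ} (hf : Measurable fun z : E × α => f z.1 z.2)
    (hd : ∀ a, Differentiable ℝ fun x => f x a) (v : E) :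
    Measurable fun z : E × α => fderiv ℝ (fun x => f x z.2) z.1 v := by
  refine measurable_of_tendsto_metrizable (f := fun (n : ℕ) (z : E × α) =>
    (n : ℝ) * (f (z.1 + (n : ℝ)⁻¹ • v) z.2 - f z.1 z.2)) (fun n => ?_) ?_
  · have : Measurable fun z : E × α => f (z.1 + (n : ℝ)⁻¹ • v) z.2 :=
      hf.comp ((measurable_fst.add_const _).prodMk measurable_snd)
    exact (this.sub hf).const_mul _
  · rw [tendsto_pi_nhds]
    intro z
    exact ((hd z.2 z.1).hasFDerivAt.lim_real v).comp tendsto_natCast_atTop_atTop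

theorem measurable_steinKernel {p : EuclideanSpace ℝ (Fin d) → ℝ}
    {k : EuclideanSpace ℝ (Fin d) → EuclideanSpace ℝ (Fin d) → ℝ}
    (hk_meas : Measurable (fun z : EuclideanSpace ℝ (Fin d) × EuclideanSpace ℝ (Fin d) =>
      k z.1 z.2))
    (hk_diff : ∀ y, Differentiable ℝ (fun x => k x y)) :
    Measurable fun z : EuclideanSpace ℝ (Fin d) × EuclideanSpace ℝ (Fin d) =>
      steinKernel p k z.1 z.2 := by
  have hs : Measurable (score p) := by
    refine measurable_euclidean fun i => ?_
    simp only [score, gradient_apply]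
    exact measurable_fderiv_apply_const ℝ _ _
  have hg : Measurable fun z : EuclideanSpace ℝ (Fin d) × EuclideanSpace ℝ (Fin d) =>
      gradient (fun x => k x z.2) z.1 := by
    refine measurable_euclidean fun i => ?_
    simp only [gradient_apply]
    exact measurable_fderiv_apply_of_differentiable hk_meas hk_diff _
  exact (hk_meas.smul (hs.comp measurable_fst)).add hg

/-- A process with almost surely continuous paths on `[0, T]` is almost surely equal there to a
jointly measurable process. -/
theorem exists_measurable_uncurry_eq_of_continuousOn {E Ω : Type*} [MeasurableSpace Ω]
    {P : Measure Ω} [TopologicalSpace E] [TopologicalSpace.PseudoMetrizableSpace E]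
    [MeasurableSpace E] [BorelSpace E] [Nonempty E] {T : ℝ} (hT : 0 ≤ T)
    {X : ℝ → Ω → E} (hm : ∀ t ∈ Icc 0 T, Measurable (X t))
    (hc : ∀ᵐ ω ∂P, ContinuousOn (fun t => X t ω) (Icc 0 T)) :
    ∃ Y : ℝ → Ω → E, Measurable (Function.uncurry Y) ∧
      ∀ᵐ ω ∂P, ∀ t ∈ Icc 0 T, Y t ω = X t ω := by
  classical
  -- The set of discontinuous paths may fail to be measurable, so a measurable null set `N`
  -- containing it is discarded. Clamping time to `[0, T]` then makes every remaining path
  -- continuous on the whole line.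
  obtain ⟨N, hN, hNm, hN0⟩ := exists_measurable_superset_of_null (ae_iff.1 hc)
  inhabit E
  refine ⟨fun t ω => if ω ∈ N then default else X (projIcc 0 T hT t) ω,
    measurable_uncurry_of_continuous_of_measurable (fun ω => ?_) fun t =>
      Measurable.ite hNm measurable_const (hm _ (projIcc 0 T hT t).2), ?_⟩
  · by_cases h : ω ∈ N
    · simp only [h, if_true]
      exact continuous_const
    · simp only [h, if_false]
      have h' : ContinuousOn (fun t => X t ω) (Icc 0 T) := by
        by_contra h''
        exact h (hN h'')
      exact h'.comp_continuous (continuous_subtype_val.comp continuous_projIcc) fun t =>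
        (projIcc 0 T hT t).2
  · have : ∀ᵐ ω ∂P, ω ∉ N := by rw [ae_iff]; simpa using hN0
    filter_upwards [this] with ω hω t ht
    simp [hω, projIcc_of_mem hT ht]

end Measurability

/-! ### The weak formulation -/

section Weak

variable {d : ℕ}

theorem fderiv_uncurry_apply {E : Type*} [NormedAddCommGroup E] [NormedSpace ℝ E]
    {ψ : ℝ → E → ℝ} {s : ℝ} {x : E}
    (h : DifferentiableAt ℝ (fun z : ℝ × E => ψ z.1 z.2) (s, x)) (v : E) :
    fderiv ℝ (fun z : ℝ × E => ψ z.1 z.2) (s, x) (1, v) =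
      deriv (fun r => ψ r x) s + fderiv ℝ (ψ s) x v := by
  have h1 : HasDerivAt (fun r => ψ r x)
      (fderiv ℝ (fun z : ℝ × E => ψ z.1 z.2) (s, x) (1, 0)) s :=
    h.hasFDerivAt.comp_hasDerivAt (f := fun r : ℝ => (r, x)) s
      ((hasDerivAt_id s).prodMk (hasDerivAt_const s x))
  have h2 : HasFDerivAt (ψ s) ((fderiv ℝ (fun z : ℝ × E => ψ z.1 z.2) (s, x)).comp
      (ContinuousLinearMap.inr ℝ ℝ E)) x :=
    h.hasFDerivAt.comp (f := fun y : E => (s, y)) x (hasFDerivAt_prodMk_right s x)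
  rw [h1.deriv, h2.fderiv, ContinuousLinearMap.comp_apply, ContinuousLinearMap.inr_apply,
    ← map_add]
  simp

/-- The differential is bounded and vanishes off the support, and `K` is the spatial projection of
the support. Hence the velocity has to be controlled over a compact set only, which is what the flux
hypothesis provides. -/
theorem exists_enorm_fderiv_apply_le {E : Type*} [NormedAddCommGroup E] [NormedSpace ℝ E]
    {Ψ : ℝ × E → ℝ} (hΨ : ContDiff ℝ 1 Ψ) (hc : HasCompactSupport Ψ) :
    ∃ (C : ENNReal) (K : Set E), C ≠ ⊤ ∧ IsCompact K ∧
      ∀ s x v, ‖fderiv ℝ Ψ (s, x) (1, v)‖ₑ ≤ C * (1 + K.indicator (fun _ => ‖v‖ₑ) x) := by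
  classical
  obtain ⟨C, hC⟩ := (hΨ.continuous_fderiv one_ne_zero).bounded_above_of_compact_support
    (hc.fderiv (𝕜 := ℝ))
  refine ⟨ENNReal.ofReal C, Prod.snd '' tsupport Ψ, ENNReal.ofReal_ne_top,
    hc.isCompact.image continuous_snd, fun s x v => ?_⟩
  by_cases hx : x ∈ Prod.snd '' tsupport Ψ
  · rw [indicator_of_mem hx]
    calc ‖fderiv ℝ Ψ (s, x) (1, v)‖ₑ ≤ ‖fderiv ℝ Ψ (s, x)‖ₑ * ‖((1 : ℝ), v)‖ₑ :=
          (fderiv ℝ Ψ (s, x)).le_opENorm _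
      _ ≤ ENNReal.ofReal C * (1 + ‖v‖ₑ) := by
          gcongr
          · rw [← ofReal_norm]
            exact ENNReal.ofReal_le_ofReal (hC _)
          · rw [enorm_eq_nnnorm, Prod.nnnorm_def, ENNReal.coe_max]
            simp [← enorm_eq_nnnorm]
  · have : (s, x) ∉ tsupport Ψ := fun h => hx ⟨_, h, rfl⟩
    rw [fderiv_of_notMem_tsupport (𝕜 := ℝ) this]
    simp

variable {Ω : Type*} [MeasurableSpace Ω] {P : Measure Ω} [IsProbabilityMeasure P]
  {p : EuclideanSpace ℝ (Fin d) → ℝ}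
  {k : EuclideanSpace ℝ (Fin d) → EuclideanSpace ℝ (Fin d) → ℝ} {T : ℝ}
  {X : ℝ → Ω → EuclideanSpace ℝ (Fin d)} {q : ℝ → EuclideanSpace ℝ (Fin d) → ℝ}

theorem IsSteinProcess.isWeakSolution (hX : IsSteinProcess P p k T X q)
    (hk_meas : Measurable (fun z : EuclideanSpace ℝ (Fin d) × EuclideanSpace ℝ (Fin d) =>
      k z.1 z.2))
    (hk_diff : ∀ y, Differentiable ℝ (fun x => k x y))
    (hflux : ∀ K : Set (EuclideanSpace ℝ (Fin d)), IsCompact K →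
      ∫⁻ t in Icc 0 T, ∫⁻ x in K, ‖flux p k (q t) x‖ₑ ≠ ⊤) :
    IsWeakSolution T q (fun t => velocity p k (q t)) := by
  intro ψ hψ hψc t ht
  have hT : 0 ≤ T := ht.1.trans ht.2
  obtain ⟨Y, hY, hYX⟩ := exists_measurable_uncurry_eq_of_continuousOn hT hX.measurable
    (hX.ode.mono fun ω h s hs => (h s hs).continuousWithinAt)
  have hYX' : ∀ s ∈ Icc 0 T, Y s =ᵐ[P] X s := fun s hs => hYX.mono fun ω h => h s hs
  have hK := measurable_steinKernel (p := p) hk_meas hk_diff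
  -- `B` agrees with the velocity on `[0, T]`, but is jointly measurable as a parametric integral
  -- over `Ω`; `q` no longer appears in it.
  set B : ℝ → EuclideanSpace ℝ (Fin d) → EuclideanSpace ℝ (Fin d) := fun s y =>
    ∫ ω, steinKernel p k (Y s ω) y ∂P with hB
  have hBm : Measurable fun z : ℝ × EuclideanSpace ℝ (Fin d) => B z.1 z.2 := by
    have h : Measurable fun w : (ℝ × EuclideanSpace ℝ (Fin d)) × Ω =>
        steinKernel p k (Y w.1.1 w.2) w.1.2 :=
      hK.comp ((hY.comp ((measurable_fst.comp measurable_fst).prodMk measurable_snd)).prodMk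
        (measurable_snd.comp measurable_fst))
    exact h.stronglyMeasurable.integral_prod_right.measurable
  have hBv : ∀ s ∈ Icc 0 T, velocity p k (q s) = B s := by
    intro s hs
    ext1 y
    have h : Measurable fun x => steinKernel p k x y := hK.comp measurable_prodMk_right
    rw [velocity, (hX.density s hs).integral_smul (hX.measurable s hs) h.stronglyMeasurable]
    exact integral_congr_ae ((hYX' s hs).mono fun ω h => by simp only [h])
  set Ψ : ℝ × EuclideanSpace ℝ (Fin d) → ℝ := fun z => ψ z.1 z.2 with hΨ
  set H : ℝ → EuclideanSpace ℝ (Fin d) → ℝ := fun s x => fderiv ℝ Ψ (s, x) (1, B s x) with hH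
  have hHm : Measurable fun z : ℝ × EuclideanSpace ℝ (Fin d) => H z.1 z.2 := by
    have h : Measurable fun z : ℝ × EuclideanSpace ℝ (Fin d) =>
        (fderiv ℝ Ψ z, ((1 : ℝ), B z.1 z.2)) :=
      (hψ.continuous_fderiv one_ne_zero).measurable.prodMk (measurable_const.prodMk hBm)
    exact (isBoundedBilinearMap_apply (𝕜 := ℝ)).continuous.measurable.comp h
  obtain ⟨C, K, hC, hKc, hle⟩ := exists_enorm_fderiv_apply_le hψ hψc
  have hGm : Measurable fun z : ℝ × Ω => H z.1 (Y z.1 z.2) :=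
    hHm.comp (measurable_fst.prodMk hY)
  have hGi : Integrable (fun z : ℝ × Ω => H z.1 (Y z.1 z.2))
      ((volume.restrict (Icc 0 T)).prod P) := by
    refine ⟨hGm.aestronglyMeasurable, ?_⟩
    rw [hasFiniteIntegral_iff_enorm, lintegral_prod _ hGm.enorm.aemeasurable]
    calc ∫⁻ s in Icc 0 T, ∫⁻ ω, ‖H s (Y s ω)‖ₑ ∂P
        ≤ ∫⁻ s in Icc 0 T, C * (1 + ∫⁻ x in K, ‖flux p k (q s) x‖ₑ) := by
          refine setLIntegral_mono' measurableSet_Icc fun s hs => ?_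
          have hBs : Measurable fun x => ‖B s x‖ₑ := (hBm.comp measurable_prodMk_left).enorm
          calc ∫⁻ ω, ‖H s (Y s ω)‖ₑ ∂P
              = ∫⁻ ω, ‖H s (X s ω)‖ₑ ∂P :=
                lintegral_congr_ae ((hYX' s hs).mono fun ω h => by simp only [h])
            _ ≤ ∫⁻ ω, C * (1 + K.indicator (fun x => ‖B s x‖ₑ) (X s ω)) ∂P := by
                refine lintegral_mono fun ω => (hle s _ _).trans (le_of_eq ?_)
                rfl
            _ = C * (1 + ∫⁻ x in K, ‖flux p k (q s) x‖ₑ) := by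
                have hi : Measurable (K.indicator (fun x => ‖B s x‖ₑ)) :=
                  hBs.indicator hKc.measurableSet
                have hiX : Measurable fun ω => K.indicator (fun x => ‖B s x‖ₑ) (X s ω) :=
                  hi.comp (hX.measurable s hs)
                rw [lintegral_const_mul _ (hiX.const_add 1),
                  lintegral_add_left measurable_const, lintegral_const, measure_univ, one_mul,
                  ← (hX.density s hs).lintegral_mul (hX.measurable s hs) hi,
                  ← lintegral_indicator hKc.measurableSet]
                congr 3 with x
                by_cases hx : x ∈ K
                · simp only [indicator_of_mem hx, flux, enorm_smul, hBv s hs,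
                    Real.enorm_of_nonneg ((hX.density s hs).nonneg x)]
                · simp only [indicator_of_notMem hx, mul_zero]
      _ < ⊤ := by
          -- Measurability in time of the flux integral is unknown; finiteness of `C` and
          -- measurability of the constant summand suffice here.
          rw [lintegral_const_mul' _ _ hC, lintegral_add_left measurable_const]
          refine ENNReal.mul_lt_top hC.lt_top (ENNReal.add_lt_top.2 ⟨?_, (hflux K hKc).lt_top⟩)
          simp
  have hsub : Ioc 0 t ⊆ Icc 0 T := fun s hs => ⟨hs.1.le, hs.2.trans ht.2⟩
  have hGt : Integrable (fun z : ℝ × Ω => H z.1 (Y z.1 z.2))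
      ((volume.restrict (Ioc 0 t)).prod P) :=
    hGi.mono_measure (Measure.prod_mono (Measure.restrict_mono hsub le_rfl) le_rfl)
  have hpath : ∀ᵐ ω ∂P, ∫ s in Ioc 0 t, H s (Y s ω) = ψ t (X t ω) - ψ 0 (X 0 ω) := by
    filter_upwards [hX.ode, hYX, hGt.prod_left_ae] with ω hode hω hint
    rw [← intervalIntegral.integral_of_le ht.1]
    have hd : ∀ s ∈ Icc 0 T, HasDerivWithinAt (fun s => ψ s (X s ω)) (H s (Y s ω))
        (Icc 0 T) s := by
      intro s hs
      have h := ((hψ.differentiable one_ne_zero) (s, X s ω)).hasFDerivAt.comp_hasDerivWithinAt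
        (f := fun s => (s, X s ω)) s ((hasDerivWithinAt_id s _).prodMk (hode s hs))
      rw [hBv s hs] at h
      simp only [hH, hω s hs]
      exact h
    refine intervalIntegral.integral_eq_sub_of_hasDeriv_right_of_le
      (f := fun s => ψ s (X s ω)) ht.1 ?_ ?_ ?_
    -- The derivative need not be continuous in time: this form of the fundamental theorem needs
    -- only its integrability, which Fubini supplies for almost every `ω`.
    · exact fun s hs => ((hd s ⟨hs.1, hs.2.trans ht.2⟩).continuousWithinAt).mono
        (Icc_subset_Icc le_rfl ht.2)
    · intro s hs
      exact ((hd s ⟨hs.1.le, hs.2.le.trans ht.2⟩).hasDerivAt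
        (Icc_mem_nhds hs.1 (hs.2.trans_le ht.2))).hasDerivWithinAt
    · rwa [intervalIntegrable_iff_integrableOn_Ioc_of_le ht.1]
  have hψi : ∀ s ∈ Icc 0 T, Integrable (fun ω => ψ s (X s ω)) P := by
    intro s hs
    obtain ⟨M, hM⟩ := hψ.continuous.bounded_above_of_compact_support hψc
    have hc : Continuous (ψ s) := hψ.continuous.comp (Continuous.prodMk_right s)
    exact Integrable.of_bound (hc.measurable.comp (hX.measurable s hs)).aestronglyMeasurable M
      (Filter.Eventually.of_forall fun ω => hM (s, X s ω))
  have hdens : ∀ s ∈ Icc 0 T, ∀ g : EuclideanSpace ℝ (Fin d) → ℝ, Measurable g →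
      ∫ x, q s x * g x = ∫ ω, g (X s ω) ∂P := fun s hs g hg =>
    (hX.density s hs).integral_smul (hX.measurable s hs) hg.stronglyMeasurable
  have hψm : ∀ s, Measurable (ψ s) := fun s =>
    (hψ.continuous.comp (Continuous.prodMk_right s)).measurable
  have h0 : (0 : ℝ) ∈ Icc 0 T := ⟨le_rfl, hT⟩
  rw [hdens t ht _ (hψm t), hdens 0 h0 _ (hψm 0), ← sub_eq_iff_eq_add',
    ← integral_sub (hψi t ht) (hψi 0 h0), ← integral_congr_ae hpath,
    integral_integral_swap (f := fun ω s => H s (Y s ω)) hGt.swap, intervalIntegral.integral_of_le ht.1]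
  refine setIntegral_congr_fun measurableSet_Ioc fun s hs => ?_
  have hs' := hsub hs
  have hgoal : (fun x => q s x * (deriv (fun r => ψ r x) s +
      inner ℝ (velocity p k (q s) x) (gradient (ψ s) x))) = fun x => q s x * H s x := by
    ext x
    rw [inner_gradient, ← fderiv_uncurry_apply ((hψ.differentiable one_ne_zero) (s, x)),
      hBv s hs']
  simp only [hgoal]
  rw [hdens s hs' (H s) (hHm.comp measurable_prodMk_left)]
  exact integral_congr_ae ((hYX' s hs').mono fun ω h => by simp only [h])

end Weak

/-! ### From the weak to the classical formulation -/

section Classical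

/-- Off its closed support `g` vanishes on a neighbourhood, so the behaviour of `f` outside `U` is
irrelevant. -/
theorem continuous_mul_of_tsupport_subset {α : Type*} [TopologicalSpace α] {f g : α → ℝ}
    {U : Set α} (hU : IsOpen U) (hf : ContinuousOn f U) (hg : Continuous g)
    (h : tsupport g ⊆ U) : Continuous fun x => f x * g x := by
  refine continuous_iff_continuousAt.2 fun x => ?_
  by_cases hx : x ∈ tsupport g
  · exact (hf.continuousAt (hU.mem_nhds (h hx))).mul hg.continuousAt
  · refine continuousAt_const.congr (f := fun _ => (0 : ℝ)) ?_
    filter_upwards [notMem_tsupport_iff_eventuallyEq.1 hx] with y hy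
    simp [hy]

theorem hasCompactSupport_comp_prodMk_left {α β : Type*} [TopologicalSpace α]
    [TopologicalSpace β] [T2Space β] {f : α × β → ℝ} (h : HasCompactSupport f) (a : α) :
    HasCompactSupport fun b => f (a, b) := by
  refine HasCompactSupport.intro (h.isCompact.image continuous_snd) fun b hb => ?_
  exact image_eq_zero_of_notMem_tsupport fun hab => hb ⟨_, hab, rfl⟩

theorem hasCompactSupport_comp_prodMk_right {α β : Type*} [TopologicalSpace α]
    [TopologicalSpace β] [T2Space α] {f : α × β → ℝ} (h : HasCompactSupport f) (b : β) :
    HasCompactSupport fun a => f (a, b) := by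
  refine HasCompactSupport.intro (h.isCompact.image continuous_fst) fun a ha => ?_
  exact image_eq_zero_of_notMem_tsupport fun hab => ha ⟨_, hab, rfl⟩

/-- Integration by parts on an open set containing the support of one factor. -/
theorem integral_mul_fderiv_of_tsupport_subset {E : Type*} [NormedAddCommGroup E]
    [NormedSpace ℝ E] [FiniteDimensional ℝ E] [MeasurableSpace E] [BorelSpace E]
    (μ : Measure E) [μ.IsAddHaarMeasure] {f g : E → ℝ} {V : Set E} (hV : IsOpen V)
    (hf : ∀ x ∈ V, DifferentiableAt ℝ f x) {v : E}
    (hf' : ContinuousOn (fun x => fderiv ℝ f x v) V) (hg : ContDiff ℝ 1 g)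
    (hc : HasCompactSupport g) (hgV : tsupport g ⊆ V) :
    Integrable (fun x => f x * fderiv ℝ g x v) μ ∧
      ∫ x, f x * fderiv ℝ g x v ∂μ = -∫ x, fderiv ℝ f x v * g x ∂μ := by
  have hfc : ContinuousOn f V := fun x hx => (hf x hx).continuousAt.continuousWithinAt
  have hg' : Continuous fun x => fderiv ℝ g x v :=
    (hg.continuous_fderiv one_ne_zero).clm_apply continuous_const
  have hc' : HasCompactSupport fun x => fderiv ℝ g x v := hc.fderiv_apply ℝ v
  have hi : Integrable (fun x => f x * fderiv ℝ g x v) μ :=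
    (continuous_mul_of_tsupport_subset hV hfc hg'
      ((tsupport_fderiv_apply_subset ℝ v).trans hgV)).integrable_of_hasCompactSupport
      (hc'.mul_left (f := f))
  refine ⟨hi, integral_mul_fderiv_eq_neg_fderiv_mul_of_integrable ?_ hi ?_
    (fun x hx => hf x (hgV hx)) fun x _ => hg.differentiable one_ne_zero x⟩
  · exact (continuous_mul_of_tsupport_subset hV hf' hg.continuous
      hgV).integrable_of_hasCompactSupport (hc.mul_left (f := fun x => fderiv ℝ f x v))
  · exact (continuous_mul_of_tsupport_subset hV hfc hg.continuous
      hgV).integrable_of_hasCompactSupport (hc.mul_left (f := f))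

variable {d : ℕ}

/-- Integration by parts for the divergence. -/
theorem integral_inner_gradient_of_tsupport_subset
    {F : EuclideanSpace ℝ (Fin d) → EuclideanSpace ℝ (Fin d)}
    {g : EuclideanSpace ℝ (Fin d) → ℝ} {V : Set (EuclideanSpace ℝ (Fin d))} (hV : IsOpen V)
    (hF : ∀ x ∈ V, DifferentiableAt ℝ F x) (hF' : ContinuousOn (fderiv ℝ F) V)
    (hg : ContDiff ℝ 1 g) (hc : HasCompactSupport g) (hgV : tsupport g ⊆ V) :
    Integrable (fun x => inner ℝ (F x) (gradient g x)) ∧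
      ∫ x, inner ℝ (F x) (gradient g x) = -∫ x, divergence F x * g x := by
  have hinner : (fun x => inner ℝ (F x) (gradient g x)) = fun x =>
      ∑ i, F x i * fderiv ℝ g x (EuclideanSpace.single i 1) := by
    ext x
    rw [PiLp.inner_apply]
    refine Finset.sum_congr rfl fun i _ => ?_
    rw [gradient_apply]
    simp [mul_comm]
  have hcoord : ∀ i, ∀ x ∈ V, HasFDerivAt (fun y => F y i)
      ((EuclideanSpace.proj i : EuclideanSpace ℝ (Fin d) →L[ℝ] ℝ).comp (fderiv ℝ F x)) x :=
    fun i x hx => ((EuclideanSpace.proj i : EuclideanSpace ℝ (Fin d) →L[ℝ] ℝ).hasFDerivAt).comp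
      x (hF x hx).hasFDerivAt
  have hval : ∀ i, ∀ x ∈ V, fderiv ℝ (fun y => F y i) x (EuclideanSpace.single i 1) =
      (fderiv ℝ F x (EuclideanSpace.single i 1)) i := fun i x hx => by
    rw [(hcoord i x hx).fderiv]
    rfl
  have hcont : ∀ i, ContinuousOn
      (fun x => (fderiv ℝ F x (EuclideanSpace.single i 1)) i) V := fun i =>
    (EuclideanSpace.proj i : EuclideanSpace ℝ (Fin d) →L[ℝ] ℝ).continuous.comp_continuousOn
      (hF'.clm_apply continuousOn_const)
  have key := fun i => integral_mul_fderiv_of_tsupport_subset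
    (volume : Measure (EuclideanSpace ℝ (Fin d))) hV
    (fun x hx => (hcoord i x hx).differentiableAt) ((hcont i).congr (hval i)) hg hc hgV
  rw [hinner]
  refine ⟨integrable_finsetSum _ fun i _ => (key i).1, ?_⟩
  rw [integral_finsetSum _ fun i _ => (key i).1]
  -- Outside `V` the two derivatives may differ, as `F` need not be differentiable there, but `g` is
  -- zero.
  have hswap : ∀ i, (fun x => fderiv ℝ (fun y => F y i) x (EuclideanSpace.single i 1) * g x) =
      fun x => (fderiv ℝ F x (EuclideanSpace.single i 1)) i * g x := by
    intro i
    ext x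
    by_cases hx : x ∈ tsupport g
    · rw [hval i x (hgV hx)]
    · rw [image_eq_zero_of_notMem_tsupport hx, mul_zero, mul_zero]
  simp only [divergence, Finset.sum_mul]
  rw [integral_finsetSum, ← Finset.sum_neg_distrib]
  · exact Finset.sum_congr rfl fun i _ => by rw [(key i).2, hswap]
  · exact fun i _ => (continuous_mul_of_tsupport_subset hV (hcont i) hg.continuous
      hgV).integrable_of_hasCompactSupport
        (hc.mul_left (f := fun x => (fderiv ℝ F x (EuclideanSpace.single i 1)) i))

/-- A weak solution solves the equation pointwise where its derivatives are continuous. -/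
theorem IsWeakSolution.deriv_eq {T : ℝ} {q : ℝ → EuclideanSpace ℝ (Fin d) → ℝ}
    {A : ℝ → EuclideanSpace ℝ (Fin d) → EuclideanSpace ℝ (Fin d)} (h : IsWeakSolution T q A)
    (hqm : ∀ t ∈ Icc 0 T, Measurable (q t)) (hq0 : ∀ t ∈ Icc 0 T, ∀ x, 0 ≤ q t x)
    (hq1 : ∀ t ∈ Icc 0 T, ∫⁻ x, ENNReal.ofReal (q t x) = 1)
    {U : Set (ℝ × EuclideanSpace ℝ (Fin d))} (hU : IsOpen U) (hUT : U ⊆ Ioo 0 T ×ˢ univ)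
    (hqd : ∀ z ∈ U, DifferentiableAt ℝ (fun s => q s z.2) z.1)
    (hqc : ContinuousOn (fun z => deriv (fun s => q s z.2) z.1) U)
    (hfd : ∀ z ∈ U, DifferentiableAt ℝ (fun x => q z.1 x • A z.1 x) z.2)
    (hfc : ContinuousOn (fun z => fderiv ℝ (fun x => q z.1 x • A z.1 x) z.2) U)
    {z : ℝ × EuclideanSpace ℝ (Fin d)} (hz : z ∈ U) :
    deriv (fun s => q s z.2) z.1 = -divergence (fun x => q z.1 x • A z.1 x) z.2 := by
  set D : ℝ × EuclideanSpace ℝ (Fin d) → ℝ := fun z => deriv (fun s => q s z.2) z.1 with hD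
  set S : ℝ × EuclideanSpace ℝ (Fin d) → ℝ := fun z =>
    divergence (fun x => q z.1 x • A z.1 x) z.2 with hS
  have hSc : ContinuousOn S U := continuousOn_finsetSum _ fun i _ =>
    (EuclideanSpace.proj i : EuclideanSpace ℝ (Fin d) →L[ℝ] ℝ).continuous.comp_continuousOn
      (hfc.clm_apply continuousOn_const)
  -- Multiplying by the value at `z` makes `G z` a square, so both signs of the defect are treated
  -- at once.
  set G : ℝ × EuclideanSpace ℝ (Fin d) → ℝ := fun w => (D w + S w) * (D z + S z) with hG
  have hGc : ContinuousOn G U := (hqc.add hSc).mul continuousOn_const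
  by_contra hne
  have hz0 : D z + S z ≠ 0 := fun h0 => hne (eq_neg_of_add_eq_zero_left h0)
  obtain ⟨φ, hφV, hφc, hφ, hφr, hφz⟩ := exists_contDiff_tsupport_subset (n := 1)
    ((hGc.isOpen_inter_preimage hU isOpen_Ioi).mem_nhds
      (show z ∈ U ∩ G ⁻¹' Ioi 0 from ⟨hz, mul_self_pos.2 hz0⟩))
  replace hφ : ContDiff ℝ 1 φ := hφ
  have hφU : tsupport φ ⊆ U := hφV.trans inter_subset_left
  have hDi : Integrable (fun w => D w * φ w) :=
    (continuous_mul_of_tsupport_subset hU hqc hφ.continuous hφU).integrable_of_hasCompactSupport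
      (hφc.mul_left (f := D))
  have hSi : Integrable (fun w => S w * φ w) :=
    (continuous_mul_of_tsupport_subset hU hSc hφ.continuous hφU).integrable_of_hasCompactSupport
      (hφc.mul_left (f := S))
  have hpos : 0 < ∫ w, G w * φ w := by
    refine (continuous_mul_of_tsupport_subset hU hGc hφ.continuous
      hφU).integral_pos_of_hasCompactSupport_nonneg_nonzero (x := z) (hφc.mul_left (f := G))
      (fun w => ?_) ?_
    · by_cases hw : w ∈ tsupport φ
      · exact mul_nonneg (le_of_lt (hφV hw).2) (hφr ⟨w, rfl⟩).1
      · simp [image_eq_zero_of_notMem_tsupport hw]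
    · rw [hφz, mul_one]
      exact (mul_self_pos.2 hz0).ne'
  have hT : 0 ≤ T := ((hUT hz).1.1.trans (hUT hz).1.2).le
  have hφ0 : ∀ s ∉ Ioo 0 T, ∀ x, (s, x) ∉ tsupport φ := fun s hs x hx => hs (hUT (hφU hx)).1
  -- the slices of `φ`
  have hφt : ∀ x, ContDiff ℝ 1 fun s => φ (s, x) := fun x =>
    hφ.comp (contDiff_id.prodMk contDiff_const)
  have hφx : ∀ s, ContDiff ℝ 1 fun x => φ (s, x) := fun s =>
    hφ.comp (contDiff_const.prodMk contDiff_id)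
  have hUt : ∀ x, IsOpen ((fun s => (s, x)) ⁻¹' U) := fun x =>
    hU.preimage (Continuous.prodMk_left x)
  have hUx : ∀ s, IsOpen ((fun x => (s, x)) ⁻¹' U) := fun s =>
    hU.preimage (Continuous.prodMk_right s)
  have hst : ∀ x, tsupport (fun s => φ (s, x)) ⊆ (fun s => (s, x)) ⁻¹' U := fun x =>
    (tsupport_comp_subset_preimage φ (Continuous.prodMk_left x)).trans (preimage_mono hφU)
  have hsx : ∀ s, tsupport (fun x => φ (s, x)) ⊆ (fun x => (s, x)) ⁻¹' U := fun s =>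
    (tsupport_comp_subset_preimage φ (Continuous.prodMk_right s)).trans (preimage_mono hφU)
  set φ' : ℝ × EuclideanSpace ℝ (Fin d) → ℝ := fun w => fderiv ℝ φ w (1, 0) with hφ'
  have hφ'd : ∀ s x, deriv (fun r => φ (r, x)) s = φ' (s, x) := by
    intro s x
    exact (((hφ.differentiable one_ne_zero) (s, x)).hasFDerivAt.comp_hasDerivAt
      (f := fun r : ℝ => (r, x)) s ((hasDerivAt_id s).prodMk (hasDerivAt_const s x))).deriv
  have hφ'c : Continuous φ' := (hφ.continuous_fderiv one_ne_zero).clm_apply continuous_const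
  have hφ's : HasCompactSupport φ' := hφc.fderiv_apply ℝ _
  have hφ'U : tsupport φ' ⊆ U := (tsupport_fderiv_apply_subset ℝ _).trans hφU
  have hφ'0 : ∀ s ∉ Ioo 0 T, ∀ x, φ' (s, x) = 0 := fun s hs x =>
    image_eq_zero_of_notMem_tsupport fun hx => hs (hUT (hφ'U hx)).1
  -- integration by parts in time
  have htime : ∀ x, ∫ s, q s x * φ' (s, x) = -∫ s, D (s, x) * φ (s, x) := by
    intro x
    have := (integral_mul_fderiv_of_tsupport_subset (volume : Measure ℝ) (v := 1) (hUt x)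
      (f := fun s => q s x) (fun s hs => hqd (s, x) hs)
      (hqc.comp (Continuous.prodMk_left x).continuousOn fun s hs => hs) (hφt x)
      (hasCompactSupport_comp_prodMk_right hφc x) (hst x)).2
    simpa only [fderiv_apply_one_eq_deriv, hφ'd] using this
  -- integration by parts in space
  have hspace : ∀ s, Integrable (fun x => inner ℝ (q s x • A s x)
        (gradient (fun y => φ (s, y)) x)) ∧
      ∫ x, inner ℝ (q s x • A s x) (gradient (fun y => φ (s, y)) x) =
        -∫ x, S (s, x) * φ (s, x) := fun s =>
    integral_inner_gradient_of_tsupport_subset (hUx s) (fun x hx => hfd (s, x) hx)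
      (hfc.comp (Continuous.prodMk_right s).continuousOn fun x hx => hx) (hφx s)
      (hasCompactSupport_comp_prodMk_left hφc s) (hsx s)
  -- joint integrability of `q * φ'`
  have hQm : Measurable (Function.uncurry fun s x => q s x * φ' (s, x)) := by
    -- The product is continuous in time, since `q` is differentiable in time on `U`, which contains
    -- the support of `φ'`; it is measurable in space.
    refine measurable_uncurry_of_continuous_of_measurable (fun x => ?_) fun s => ?_
    · refine continuous_mul_of_tsupport_subset (hUt x) (f := fun s => q s x)
        (fun s hs => (hqd (s, x) hs).continuousAt.continuousWithinAt)
        (hφ'c.comp (Continuous.prodMk_left x)) ?_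
      exact (tsupport_comp_subset_preimage φ' (Continuous.prodMk_left x)).trans
        (preimage_mono hφ'U)
    · by_cases hs : s ∈ Ioo 0 T
      · exact (hqm s (Ioo_subset_Icc_self hs)).mul
          (hφ'c.comp (Continuous.prodMk_right s)).measurable
      · simp only [hφ'0 s hs, mul_zero]
        exact measurable_const
  obtain ⟨M, hM⟩ := hφ'c.bounded_above_of_compact_support hφ's
  have hQi : Integrable (Function.uncurry fun s x => q s x * φ' (s, x))
      (volume.prod volume) := by
    refine ⟨hQm.aestronglyMeasurable, ?_⟩
    rw [hasFiniteIntegral_iff_enorm, lintegral_prod _ hQm.enorm.aemeasurable]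
    calc ∫⁻ s, ∫⁻ x, ‖q s x * φ' (s, x)‖ₑ
        ≤ ∫⁻ s, (Icc 0 T).indicator (fun _ => ENNReal.ofReal M) s := by
          refine lintegral_mono fun s => ?_
          by_cases hs : s ∈ Icc 0 T
          · rw [indicator_of_mem hs]
            calc ∫⁻ x, ‖q s x * φ' (s, x)‖ₑ
                ≤ ∫⁻ x, ENNReal.ofReal (q s x) * ENNReal.ofReal M := by
                  refine lintegral_mono fun x => ?_
                  simp only [enorm_mul, Real.enorm_of_nonneg (hq0 s hs x)]
                  gcongr
                  rw [← ofReal_norm]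
                  exact ENNReal.ofReal_le_ofReal (hM _)
              _ = ENNReal.ofReal M := by
                  rw [lintegral_mul_const _ (hqm s hs).ennreal_ofReal, hq1 s hs, one_mul]
          · simp [hφ'0 s fun h => hs (Ioo_subset_Icc_self h)]
      _ < ⊤ := by
          rw [lintegral_indicator measurableSet_Icc, setLIntegral_const]
          exact ENNReal.mul_lt_top ENNReal.ofReal_lt_top (by simp)
  have hQx : ∀ s, Integrable fun x => q s x * φ' (s, x) := by
    intro s
    by_cases hs : s ∈ Icc 0 T
    · have hq : Integrable (q s) := by
        refine ⟨(hqm s hs).aestronglyMeasurable, ?_⟩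
        rw [hasFiniteIntegral_iff_ofReal (Filter.Eventually.of_forall (hq0 s hs)), hq1 s hs]
        exact ENNReal.one_lt_top
      exact hq.mul_bdd (hφ'c.comp (Continuous.prodMk_right s)).aestronglyMeasurable
        (Filter.Eventually.of_forall fun x => hM _)
    · simp only [hφ'0 s fun h => hs (Ioo_subset_Icc_self h), mul_zero]
      exact integrable_zero _ _ _
  -- The bump vanishes at times `0` and `T`, so no boundary terms survive.
  have hw := h (fun s x => φ (s, x)) hφ hφc T ⟨hT, le_rfl⟩
  have hT0 : ∀ x, φ (T, x) = 0 := fun x =>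
    image_eq_zero_of_notMem_tsupport (hφ0 T (fun h => lt_irrefl _ h.2) x)
  have h00 : ∀ x, φ (0, x) = 0 := fun x =>
    image_eq_zero_of_notMem_tsupport (hφ0 0 (fun h => lt_irrefl _ h.1) x)
  have hslice : ∀ s, ∫ x, q s x * (deriv (fun r => φ (r, x)) s +
      inner ℝ (A s x) (gradient (fun y => φ (s, y)) x)) =
      (∫ x, q s x * φ' (s, x)) - ∫ x, S (s, x) * φ (s, x) := by
    intro s
    rw [sub_eq_add_neg, ← (hspace s).2, ← integral_add (hQx s) (hspace s).1]
    simp only [hφ'd, mul_add, real_inner_smul_left]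
  simp only [hT0, h00, mul_zero, integral_zero, zero_add, hslice] at hw
  rw [intervalIntegral.integral_of_le hT, setIntegral_eq_integral_of_forall_compl_eq_zero] at hw
  · have hSi' : Integrable (Function.uncurry fun s x => S (s, x) * φ (s, x))
        (volume.prod volume) := hSi
    have hDi' : Integrable (Function.uncurry fun s x => D (s, x) * φ (s, x))
        (volume.prod volume) := hDi
    have hQt : Integrable fun s => ∫ x, q s x * φ' (s, x) := hQi.integral_prod_left
    have hSt : Integrable fun s => ∫ x, S (s, x) * φ (s, x) := hSi'.integral_prod_left
    -- Integration by parts in time acts on slices with `x` fixed, so the order of integration is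
    -- exchanged before it and restored after it.
    rw [integral_sub hQt hSt,
      integral_integral_swap hQi] at hw
    simp only [htime, integral_neg] at hw
    rw [← integral_integral_swap hDi', integral_integral hDi', integral_integral hSi'] at hw
    have hG0 : ∫ w, G w * φ w = ((∫ w, D w * φ w) + ∫ w, S w * φ w) * (D z + S z) := by
      rw [← integral_add hDi hSi, ← integral_mul_const]
      refine integral_congr_ae (Filter.Eventually.of_forall fun w => ?_)
      simp only [hG]
      ring
    have hsum : (∫ w, D w * φ w) + ∫ w, S w * φ w = 0 := by
      rw [Measure.volume_eq_prod]
      linarith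
    rw [hG0, hsum, zero_mul] at hpos
    exact lt_irrefl _ hpos
  · intro s hs
    have hs' : s ∉ Ioo 0 T := fun h => hs (Ioo_subset_Ioc_self h)
    simp [hφ'0 s hs', image_eq_zero_of_notMem_tsupport (hφ0 s hs' _)]

end Classical

end SteinFlow

theorem mainTheorem11 {d : ℕ} {Ω : Type*} [MeasurableSpace Ω]
    (P : Measure Ω) [IsProbabilityMeasure P]
    (p : EuclideanSpace ℝ (Fin d) → ℝ) (hp_pos : ∀ x, 0 < p x) (hp_diff : Differentiable ℝ p)
    (k : EuclideanSpace ℝ (Fin d) → EuclideanSpace ℝ (Fin d) → ℝ)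
    (hk_meas : Measurable (fun z : EuclideanSpace ℝ (Fin d) × EuclideanSpace ℝ (Fin d) =>
      k z.1 z.2))
    (hk_diff : ∀ y, Differentiable ℝ (fun x => k x y))
    (T : ℝ) (X : ℝ → Ω → EuclideanSpace ℝ (Fin d)) (q : ℝ → EuclideanSpace ℝ (Fin d) → ℝ)
    (hX : SteinFlow.IsSteinProcess P p k T X q)
    (hflux : ∀ K : Set (EuclideanSpace ℝ (Fin d)), IsCompact K →
      ∫⁻ t in Icc 0 T, ∫⁻ x in K, ‖SteinFlow.flux p k (q t) x‖ₑ ≠ ⊤) :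
    SteinFlow.IsWeakSolution T q (fun t => SteinFlow.velocity p k (q t)) ∧
    ∀ U : Set (ℝ × EuclideanSpace ℝ (Fin d)), IsOpen U → U ⊆ Ioo 0 T ×ˢ univ →
      (∀ z ∈ U, DifferentiableAt ℝ (fun s => q s z.2) z.1) →
      ContinuousOn (fun z => deriv (fun s => q s z.2) z.1) U →
      (∀ z ∈ U, DifferentiableAt ℝ (SteinFlow.flux p k (q z.1)) z.2) →
      ContinuousOn (fun z => fderiv ℝ (SteinFlow.flux p k (q z.1)) z.2) U →
      ∀ z ∈ U, deriv (fun s => q s z.2) z.1 =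
        -SteinFlow.divergence (SteinFlow.flux p k (q z.1)) z.2 := by
  refine ⟨hX.isWeakSolution hk_meas hk_diff hflux, fun U hU hUT hqd hqc hfd hfc z hz => ?_⟩
  exact (hX.isWeakSolution hk_meas hk_diff hflux).deriv_eq
    (fun t ht => (hX.density t ht).measurable) (fun t ht => (hX.density t ht).nonneg)
    (fun t ht => (hX.density t ht).lintegral_eq_one (hX.measurable t ht))
    hU hUT hqd hqc hfd hfc hz
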